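/- Let $n\ge 1$ and let $\mathbf u=(u_1,\dots,u_n)\in\mathbb R^n$ satisfy $0\le u_1\le\cdots\le u_n$ and $\mathbf u\ne\mathbf 0$. Let $d_1<\cdots<d_\ell$ ($\ell\ge 1$) be the distinct positive entries of $\mathbf u$, let $m_0$ be the number of entries of $\mathbf u$ equal to $0$, and for $1\le i\le\ell$ let $m_i$ be the number of entries equal to $d_i$; put $\mathbf m=(m_0,m_1,\dots,m_\ell)$ and $\mathbf d=(d_1,\dots,d_\ell)$, so that $m_0+\cdots+m_\ell=n$ and $(\mathbf m,\mathbf d)$ determines $\mathbf u$. A vector $\mathbf a\in\mathbb R^n_{\ge 0}$ is a $\mathbf u$-parking function if its non-decreasing rearrangement $b_1\le\cdots\le b_n$ satisfies $b_i\le u_i$ for all $i$, and the parking function polytope $\mathrm{PF}(\mathbf m,\mathbf d)=\mathrm{PF}(\mathbf u)$ is the convex hull of all $\mathbf u$-parking functions. A polytope of dimension $D$ is called simple if each of its vertices is incident to exactly $D$ edges. Then $\mathrm{PF}(\mathbf m,\mathbf d)$ is a simple polytope if and only if one of the following holds: (a) $\mathbf m=(0,n)$; (b) $\mathbf m=(n-1,1)$;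 (c) $\ell\ge 2$ and $m_1=m_2=\cdots=m_{\ell-1}=1$. -/

import Mathlib

/-- `a ∈ ℝⁿ` is a `u`-parking function: its entries are nonnegative and its non-decreasing
rearrangement `b = a ∘ Tuple.sort a` satisfies `b i ≤ u i` for all `i`. -/
def IsParkingFunction {n : ℕ} (u a : Fin n → ℝ) : Prop :=
  (∀ i, 0 ≤ a i) ∧ ∀ i, a (Tuple.sort a i) ≤ u i

/-- The parking function polytope `PF(u)`: the convex hull of all `u`-parking functions. -/
def parkingPolytope {n : ℕ} (u : Fin n → ℝ) : Set (Fin n → ℝ) :=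
  convexHull ℝ {a | IsParkingFunction u a}

/-- `(m, d)` is the multiplicity-data pair of the nonzero non-decreasing nonnegative vector `u`:
`d = (d₁ < ⋯ < d_ℓ)` lists the distinct positive entries of `u` (here `d i` is `d_{i+1}`), `m 0` is
the number of zero entries, and `m i.succ` is the number of entries equal to `d i`. -/
structure IsMDPair {n ℓ : ℕ} (u : Fin n → ℝ) (m : Fin (ℓ + 1) → ℕ) (d : Fin ℓ → ℝ) : Prop where
  monotone : Monotone u
  nonneg : ∀ j, 0 ≤ u j
  ne_zero : u ≠ 0
  strictMono : StrictMono d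
  range_eq : Set.range d = {x | x ∈ Set.range u ∧ 0 < x}
  mult_zero : m 0 = (Finset.univ.filter fun j => u j = 0).card
  mult_succ : ∀ i : Fin ℓ, m i.succ = (Finset.univ.filter fun j => u j = d i).card

/-- A polytope in `ℝⁿ`: the convex hull of finitely many points. -/
def IsPolytope {n : ℕ} (P : Set (Fin n → ℝ)) : Prop :=
  ∃ s : Finset (Fin n → ℝ), P = convexHull ℝ (s : Set (Fin n → ℝ))

/-- The dimension of a nonempty set in `ℝⁿ`: the dimension of its affine span. -/
noncomputable def affineDim {n : ℕ} (S : Set (Fin n → ℝ)) : ℕ :=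
  Module.finrank ℝ (affineSpan ℝ S).direction

/-- `v` is a vertex of `P`: `{v}` is a face of `P`, where a face is the set of maximizers over `P`
of a linear functional. -/
def IsVertex {n : ℕ} (P : Set (Fin n → ℝ)) (v : Fin n → ℝ) : Prop :=
  IsExposed ℝ P {v}

/-- `E` is an edge of `P`: a one-dimensional face. -/
def IsEdge {n : ℕ} (P E : Set (Fin n → ℝ)) : Prop :=
  IsExposed ℝ P E ∧ affineDim E = 1

/-- A polytope is simple if every vertex is incident to exactly `dim P` edges. -/
def IsSimplePolytope {n : ℕ} (P : Set (Fin n → ℝ)) : Prop :=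
  IsPolytope P ∧
    ∀ v, IsVertex P v → {E | IsEdge P E ∧ v ∈ E}.encard = (affineDim P : ℕ∞)

namespace ParkingPolytope

open Finset

variable {n : ℕ} {u : Fin n → ℝ}

/-! The polytope contains 0 and a positive multiple of every unit vector, so its dimension is n and
simplicity means n edges at each vertex. Two kinds of inequalities hold on it: `0 ≤ x i`, and `∑ i ∈
T, x i ≤ ∑ i ∈ T, u i` for sets `T` of largest entries (`IsTop.sum_le`). By the rearrangement
inequality every vertex is, up to a permutation of coordinates, `u` with an initial stretch replaced
by zeros (`exists_eq_truncation_comp`).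

The condition on multiplicities becomes the condition `HasSimpleType` on `u`. If it holds, then at
every truncation n of these inequalities are dual to n directions into the polytope. The tangent
cone is then simplicial, and its n rays are exactly the edges (`IsSimplicialAt.encard_edges`).

If it fails, the vertex `u` itself is the obstruction. Exchanging two entries with consecutive
values, or lowering a smallest positive entry to 0, moves along an edge at `u`. A repeated positive
value below the maximum, or a repeated single positive value in the presence of zeros, yields n + 1
such edges (`lt_encard_edges`). -/

/-! ### Parking functions, valid inequalities and dimension -/

theorem isParkingFunction_iff (hu : Monotone u) {a : Fin n → ℝ} :
    IsParkingFunction u a ↔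
      (∀ i, 0 ≤ a i) ∧ ∃ σ : Equiv.Perm (Fin n), ∀ i, a i ≤ u (σ i) := by
  constructor
  · rintro ⟨h0, h⟩
    refine ⟨h0, (Tuple.sort a).symm, fun i => ?_⟩
    simpa using h ((Tuple.sort a).symm i)
  · rintro ⟨h0, σ, h⟩
    refine ⟨h0, fun i => ?_⟩
    by_contra! hlt
    -- Otherwise the injection `σ ∘ Tuple.sort a` sends the n - i positions from `i` on into the n -
    -- i - 1 positions after `i`.
    have hc : (Finset.Ici i).card ≤ (Finset.Ioi i).card := by
      refine Finset.card_le_card_of_injOn (fun j => σ (Tuple.sort a j)) ?_ ?_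
      · intro j hj
        simp only [Finset.coe_Ici, Set.mem_Ici, Finset.coe_Ioi, Set.mem_Ioi] at hj ⊢
        by_contra! hle
        have h1 := Tuple.monotone_sort a hj
        have h2 := h (Tuple.sort a j)
        have h3 := hu hle
        simp only [Function.comp] at h1
        linarith
      · intro x _ y _ hxy
        simpa using hxy
    rw [Fin.card_Ici, Fin.card_Ioi] at hc
    have := i.isLt
    omega

theorem mem_of_le (hu : Monotone u) {a : Fin n → ℝ} (h0 : ∀ i, 0 ≤ a i)
    (σ : Equiv.Perm (Fin n)) (h : ∀ i, a i ≤ u (σ i)) : a ∈ parkingPolytope u :=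
  subset_convexHull ℝ _ ((isParkingFunction_iff hu).2 ⟨h0, σ, h⟩)

theorem le_of_forall_parking (g : (Fin n → ℝ) →ₗ[ℝ] ℝ) (c : ℝ)
    (h : ∀ a, IsParkingFunction u a → g a ≤ c) {x : Fin n → ℝ}
    (hx : x ∈ parkingPolytope u) : g x ≤ c :=
  convexHull_min (t := {x | g x ≤ c}) h (convex_halfSpace_le g.isLinear c) hx

theorem nonneg_of_mem {x : Fin n → ℝ} (hx : x ∈ parkingPolytope u) (i : Fin n) : 0 ≤ x i := by
  have := le_of_forall_parking (-LinearMap.proj i) 0 (fun a ha => by simpa using ha.1 i) hx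
  simpa using this

/-- Every entry of `u` indexed by `T` is at least every entry indexed outside of `T`. -/
def IsTop (u : Fin n → ℝ) (T : Finset (Fin n)) : Prop :=
  ∀ a ∈ T, ∀ b ∉ T, u b ≤ u a

/-- Rearrangement inequality for `u` against the indicator function of `T`. -/
theorem IsTop.sum_comp_perm_le {T : Finset (Fin n)} (hT : IsTop u T)
    (σ : Equiv.Perm (Fin n)) : ∑ i ∈ T, u (σ i) ≤ ∑ i ∈ T, u i := by
  classical
  have hm : Monovary (fun i => if i ∈ T then (1 : ℝ) else 0) u := by
    intro i j hij
    by_cases hi : i ∈ T <;> by_cases hj : j ∈ T <;> simp [hi, hj]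
    exact absurd (hT i hi j hj) (not_le.2 hij)
  have := hm.sum_mul_comp_perm_le_sum_mul (σ := σ)
  simpa using this

theorem IsTop.sum_le {T : Finset (Fin n)} (hu : Monotone u) (hT : IsTop u T) {x : Fin n → ℝ}
    (hx : x ∈ parkingPolytope u) : ∑ i ∈ T, x i ≤ ∑ i ∈ T, u i := by
  have := le_of_forall_parking (∑ i ∈ T, LinearMap.proj i) (∑ i ∈ T, u i) (fun a ha => ?_) hx
  · simpa using this
  · obtain ⟨-, σ, hσ⟩ := (isParkingFunction_iff hu).1 ha
    simpa using (Finset.sum_le_sum fun i _ => hσ i).trans (hT.sum_comp_perm_le σ)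

/-- The parking functions are a finite union of boxes `[0, u ∘ σ]`, and each box is the convex hull
of its corners. -/
theorem isPolytope (hu : Monotone u) (h0 : ∀ i, 0 ≤ u i) : IsPolytope (parkingPolytope u) := by
  classical
  refine ⟨Finset.univ.biUnion fun σ : Equiv.Perm (Fin n) =>
    Fintype.piFinset fun i => {0, u (σ i)}, ?_⟩
  apply Set.Subset.antisymm
  · refine convexHull_min ?_ (convex_convexHull ℝ _)
    intro a ha
    obtain ⟨ha0, σ, hσ⟩ := (isParkingFunction_iff hu).1 ha
    have hsub : (Set.univ.pi fun i => ({0, u (σ i)} : Set ℝ)) ⊆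
        ((Finset.univ.biUnion fun σ : Equiv.Perm (Fin n) =>
          Fintype.piFinset fun i => {0, u (σ i)} : Finset (Fin n → ℝ)) : Set (Fin n → ℝ)) := by
      intro x hx
      simp only [Set.mem_pi, Set.mem_univ, forall_true_left] at hx
      simp only [Finset.coe_biUnion, Set.mem_iUnion, Finset.mem_coe, Fintype.mem_piFinset]
      exact ⟨σ, Finset.mem_univ _, fun i => by simpa using hx i⟩
    refine convexHull_mono hsub ?_
    rw [convexHull_pi]
    intro i _
    simp only [convexHull_pair, segment_eq_Icc (h0 _)]
    exact ⟨ha0 i, hσ i⟩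
  · refine convexHull_mono ?_
    intro x hx
    simp only [Finset.coe_biUnion, Set.mem_iUnion, Finset.mem_coe, Fintype.mem_piFinset] at hx
    obtain ⟨σ, -, hσ⟩ := hx
    refine (isParkingFunction_iff hu).2 ⟨fun i => ?_, σ, fun i => ?_⟩
    all_goals
      have := hσ i
      simp only [Finset.mem_insert, Finset.mem_singleton] at this
      have := h0 (σ i)
      rcases ‹x i = 0 ∨ _› with h | h <;> linarith

theorem affineDim_parkingPolytope (hu : Monotone u) (h0 : ∀ i, 0 ≤ u i) (hne : u ≠ 0) :
    affineDim (parkingPolytope u) = n := by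
  obtain ⟨t, ht⟩ := Function.ne_iff.1 hne
  have ht : 0 < u t := lt_of_le_of_ne (h0 t) (Ne.symm ht)
  have hz : (0 : Fin n → ℝ) ∈ parkingPolytope u := mem_of_le hu (by simp) 1 (by simpa using h0)
  have htop : (affineSpan ℝ (parkingPolytope u)).direction = ⊤ := by
    rw [eq_top_iff, ← (Pi.basisFun ℝ (Fin n)).span_eq, Submodule.span_le]
    rintro _ ⟨i, rfl⟩
    have hi : Pi.single i (u t) ∈ parkingPolytope u := by
      refine mem_of_le hu (fun j => ?_) (Equiv.swap i t) (fun j => ?_)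
      · by_cases h : j = i
        · subst h; simpa using ht.le
        · simp [h]
      · by_cases h : j = i
        · subst h; simp
        · simp [h, h0]
    have := AffineSubspace.vsub_mem_direction (subset_affineSpan ℝ _ hi)
      (subset_affineSpan ℝ _ hz)
    have h2 := Submodule.smul_mem _ (u t)⁻¹ this
    have h3 : (u t)⁻¹ • (Pi.single i (u t) -ᵥ (0 : Fin n → ℝ)) = Pi.basisFun ℝ (Fin n) i := by
      ext j
      by_cases h : j = i
      · subst h; simp [ht.ne']
      · simp [h]
    rwa [h3] at h2
  rw [affineDim, htop]
  simp

/-! ### Vertices are permuted truncations -/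

theorem exists_threshold {p : Fin n → Prop} (hp : ∀ i j, i ≤ j → p j → p i) :
    ∃ k ≤ n, ∀ i : Fin n, (i : ℕ) < k ↔ p i := by
  classical
  by_cases h : ∃ k, ∃ hk : k < n, ¬ p ⟨k, hk⟩
  · obtain ⟨hk, hk'⟩ := Nat.find_spec h
    refine ⟨Nat.find h, hk.le, fun i => ⟨fun hi => ?_, fun hi => ?_⟩⟩
    · have := Nat.find_min h hi
      push Not at this
      exact this i.isLt
    · by_contra! hle
      exact hk' (hp _ i hle hi)
  · push Not at h
    exact ⟨n, le_rfl, fun i => ⟨fun _ => h i i.isLt, fun _ => i.isLt⟩⟩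

/-- The vector `u` with its first `k` entries replaced by zero. -/
def truncation (u : Fin n → ℝ) (k : ℕ) : Fin n → ℝ := fun i => if (i : ℕ) < k then 0 else u i

/-- The vertex is the only maximizer of some functional. Sorting the coefficients and pairing the
positive ones with the largest entries of `u` gives a maximizer of truncation form, which is
therefore the vertex. -/
theorem exists_eq_truncation_comp (hu : Monotone u) (h0 : ∀ i, 0 ≤ u i) {v : Fin n → ℝ}
    (hv : IsVertex (parkingPolytope u) v) :
    ∃ k ≤ n, ∃ τ : Equiv.Perm (Fin n), v = truncation u k ∘ τ := by
  obtain ⟨l, hl⟩ := hv (Set.singleton_nonempty v)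
  set c : Fin n → ℝ := fun i => l (Pi.single i 1) with hc
  have hlc : ∀ x, l x = ∑ i, c i * x i := by
    intro x
    have := LinearMap.pi_apply_eq_sum_univ (l : (Fin n → ℝ) →ₗ[ℝ] ℝ) x
    simp only [ContinuousLinearMap.coe_coe] at this
    rw [this]
    refine Finset.sum_congr rfl fun i _ => ?_
    rw [smul_eq_mul, mul_comm, hc]
    congr 2
    ext j
    simp [Pi.single_apply, eq_comm]
  set τ := Tuple.sort c with hτ
  have hmono : Monotone (c ∘ τ) := Tuple.monotone_sort c
  obtain ⟨k, hkn, hk⟩ := exists_threshold (p := fun i => ¬ 0 < c (τ i)) (by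
    intro i j hij hj hi
    exact hj (hi.trans_le (hmono hij)))
  refine ⟨k, hkn, τ.symm, ?_⟩
  have hval : ∀ i, (truncation u k ∘ τ.symm) i = if 0 < c i then u (τ.symm i) else 0 := by
    intro i
    have := hk (τ.symm i)
    simp only [Equiv.apply_symm_apply] at this
    simp only [Function.comp, truncation, this]
    split_ifs <;> rfl
  have hmem : truncation u k ∘ τ.symm ∈ parkingPolytope u := by
    refine mem_of_le hu (fun i => ?_) τ.symm (fun i => ?_) <;> rw [hval] <;> split_ifs <;>
      first | exact h0 _ | exact le_rfl
  have hmax : ∀ y ∈ parkingPolytope u, l y ≤ l (truncation u k ∘ τ.symm) := by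
    intro y hy
    refine le_of_forall_parking (l : (Fin n → ℝ) →ₗ[ℝ] ℝ) _ (fun a ha => ?_) hy
    obtain ⟨ha0, σ, hσ⟩ := (isParkingFunction_iff hu).1 ha
    simp only [ContinuousLinearMap.coe_coe, hlc]
    -- Since `a` is nonnegative, a coefficient may be replaced by its positive part; this keeps the
    -- order needed for rearrangement.
    have hm : Monovary (fun i => max (c i) 0) (u ∘ τ.symm) := by
      intro i j hij
      have : τ.symm i ≤ τ.symm j := by
        by_contra! h
        exact absurd (hu h.le) (not_le.2 hij)
      have h2 := hmono this
      simp only [Function.comp, Equiv.apply_symm_apply] at h2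
      exact max_le_max h2 le_rfl
    calc ∑ i, c i * a i ≤ ∑ i, max (c i) 0 * (u ∘ τ.symm) ((σ.trans τ) i) := by
          refine Finset.sum_le_sum fun i _ => ?_
          simp only [Function.comp, Equiv.trans_apply, Equiv.symm_apply_apply]
          exact (mul_le_mul_of_nonneg_right (le_max_left _ _) (ha0 i)).trans
            (mul_le_mul_of_nonneg_left (hσ i) (le_max_right _ _))
      _ ≤ ∑ i, max (c i) 0 * (u ∘ τ.symm) i := hm.sum_mul_comp_perm_le_sum_mul
      _ = _ := by
          refine Finset.sum_congr rfl fun i _ => ?_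
          rw [hval]
          split_ifs with h
          · rw [max_eq_left h.le]; rfl
          · rw [max_eq_right (not_lt.1 h)]; simp
  have : truncation u k ∘ τ.symm ∈ ({v} : Set (Fin n → ℝ)) := by
    rw [hl]; exact ⟨hmem, hmax⟩
  exact this.symm

/-! ### Counting edges at a simplicial vertex -/

theorem affineDim_eq_one {E : Set (Fin n → ℝ)} {v w : Fin n → ℝ} (hv : v ∈ E)
    (hvw : v + w ∈ E) (hw : w ≠ 0) (h : ∀ x ∈ E, ∃ c : ℝ, x - v = c • w) :
    affineDim E = 1 := by
  rw [affineDim, direction_affineSpan, vectorSpan_eq_span_vsub_set_right ℝ hv]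
  have : Submodule.span ℝ ((fun x => x -ᵥ v) '' E) = Submodule.span ℝ {w} := by
    apply le_antisymm
    · rw [Submodule.span_le]
      rintro _ ⟨x, hx, rfl⟩
      obtain ⟨c, hc⟩ := h x hx
      exact Submodule.mem_span_singleton.2 ⟨c, hc.symm⟩
    · rw [Submodule.span_singleton_le_iff_mem]
      exact Submodule.subset_span ⟨v + w, hvw, by simp⟩
  rw [this, finrank_span_singleton hw]

/-- The points of `P` at which all functionals of a finite family of functionals that are maximal
over `P` at `v` take the same values as at `v` form an exposed face. -/
theorem isExposed_of_family {ι : Type*} {P : Set (Fin n → ℝ)} {v : Fin n → ℝ} (hv : v ∈ P)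
    (s : Finset ι) (g : ι → (Fin n → ℝ) →ₗ[ℝ] ℝ) (hg : ∀ i ∈ s, ∀ x ∈ P, g i x ≤ g i v) :
    IsExposed ℝ P {x ∈ P | ∀ i ∈ s, g i x = g i v} := by
  intro _
  -- Every summand is maximal at `v`, so the sum is maximal exactly where all summands are.
  refine ⟨LinearMap.toContinuousLinearMap (∑ i ∈ s, g i), ?_⟩
  ext x
  simp only [Set.mem_ofPred_eq, LinearMap.coe_toContinuousLinearMap', LinearMap.coe_sum,
    Finset.sum_apply]
  refine and_congr_right fun hx => ⟨fun h y hy => ?_, fun h => ?_⟩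
  · rw [Finset.sum_congr rfl h]
    exact Finset.sum_le_sum fun i hi => hg i hi y hy
  · exact (Finset.sum_eq_sum_iff_of_le fun i hi => hg i hi x hx).1
      (le_antisymm (Finset.sum_le_sum fun i hi => hg i hi x hx) (h v hv))

/-- Linearly independent directions `w i` from `v` into `P`, with dual functionals `f i`,
that generate a cone containing `P - v`. -/
structure IsSimplicialAt (P : Set (Fin n → ℝ)) (v : Fin n → ℝ) (w : Fin n → Fin n → ℝ)
    (f : Fin n → (Fin n → ℝ) →ₗ[ℝ] ℝ) : Prop where
  mem : v ∈ P
  add_mem : ∀ i, v + w i ∈ P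
  pos : ∀ i, 0 < f i (w i)
  eq_zero : ∀ i j, i ≠ j → f i (w j) = 0
  le : ∀ x ∈ P, ∀ i, f i v ≤ f i x

namespace IsSimplicialAt

variable {P : Set (Fin n → ℝ)} {v : Fin n → ℝ} {w : Fin n → Fin n → ℝ}
  {f : Fin n → (Fin n → ℝ) →ₗ[ℝ] ℝ}

theorem comp (h : IsSimplicialAt P v w f) (τ : Equiv.Perm (Fin n))
    (hP : ∀ τ : Equiv.Perm (Fin n), ∀ x ∈ P, x ∘ τ ∈ P) :
    IsSimplicialAt P (v ∘ τ) (fun i => w i ∘ τ)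
      (fun i => f i ∘ₗ LinearMap.funLeft ℝ ℝ τ.symm) where
  mem := hP τ _ h.mem
  add_mem i := hP τ _ (h.add_mem i)
  pos i := by
    have : (w i ∘ τ) ∘ τ.symm = w i := by ext; simp
    simpa [LinearMap.funLeft, this] using h.pos i
  eq_zero i j hij := by
    have : (w j ∘ τ) ∘ τ.symm = w j := by ext; simp
    simpa [LinearMap.funLeft, this] using h.eq_zero i j hij
  le x hx i := by
    have : (v ∘ τ) ∘ τ.symm = v := by ext; simp
    simpa [LinearMap.funLeft, this] using h.le _ (hP τ.symm x hx) i

theorem apply_sum (h : IsSimplicialAt P v w f) (c : Fin n → ℝ) (i : Fin n) :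
    f i (∑ j, c j • w j) = c i * f i (w i) := by
  rw [map_sum, Finset.sum_eq_single i]
  · simp
  · intro j _ hj
    simp [h.eq_zero i j hj.symm]
  · simp

theorem linearIndependent (h : IsSimplicialAt P v w f) : LinearIndependent ℝ w := by
  rw [Fintype.linearIndependent_iff]
  intro c hc i
  have := h.apply_sum c i
  rw [hc, map_zero] at this
  exact (mul_eq_zero.1 this.symm).resolve_right (h.pos i).ne'

theorem exists_eq_sum (h : IsSimplicialAt P v w f) (x : Fin n → ℝ) :
    x = ∑ i, (f i x / f i (w i)) • w i := by
  have hspan := h.linearIndependent.span_eq_top_of_card_eq_finrank' (by simp)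
  have hx : x ∈ Submodule.span ℝ (Set.range w) := by rw [hspan]; trivial
  obtain ⟨c, hc⟩ := (Submodule.mem_span_range_iff_exists_fun ℝ).1 hx
  conv_lhs => rw [← hc]
  refine Finset.sum_congr rfl fun i _ => ?_
  rw [← hc, h.apply_sum, mul_div_cancel_right₀ _ (h.pos i).ne']

theorem ne_zero (h : IsSimplicialAt P v w f) (i : Fin n) : w i ≠ 0 := fun hw => by
  simpa [hw] using h.pos i

/-- The edge of `P` from `v` in the direction `w i`. -/
def edge (P : Set (Fin n → ℝ)) (v : Fin n → ℝ) (f : Fin n → (Fin n → ℝ) →ₗ[ℝ] ℝ) (i : Fin n) :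
    Set (Fin n → ℝ) :=
  {x ∈ P | ∀ j ∈ Finset.univ.erase i, (-f j) x = (-f j) v}

theorem mem_edge {i : Fin n} {x : Fin n → ℝ} :
    x ∈ edge P v f i ↔ x ∈ P ∧ ∀ j, j ≠ i → f j (x - v) = 0 := by
  simp [edge, sub_eq_zero]

theorem add_mem_edge (h : IsSimplicialAt P v w f) (i : Fin n) : v + w i ∈ edge P v f i :=
  mem_edge.2 ⟨h.add_mem i, fun j hj => by simpa using h.eq_zero j i hj⟩

theorem self_mem_edge (h : IsSimplicialAt P v w f) (i : Fin n) : v ∈ edge P v f i :=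
  mem_edge.2 ⟨h.mem, by simp⟩

theorem exists_smul_of_mem_edge (h : IsSimplicialAt P v w f) {i : Fin n} {x : Fin n → ℝ}
    (hx : x ∈ edge P v f i) : ∃ c : ℝ, x - v = c • w i := by
  refine ⟨f i (x - v) / f i (w i), ?_⟩
  conv_lhs => rw [h.exists_eq_sum (x - v)]
  refine Finset.sum_eq_single i (fun j _ hj => ?_) (by simp)
  rw [(mem_edge.1 hx).2 j hj, zero_div, zero_smul]

theorem isEdge_edge (h : IsSimplicialAt P v w f) (i : Fin n) : IsEdge P (edge P v f i) :=
  ⟨isExposed_of_family h.mem _ _ fun j _ x hx => by simpa using h.le x hx j,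
    affineDim_eq_one (h.self_mem_edge i) (h.add_mem_edge i) (h.ne_zero i)
      fun _ hx => h.exists_smul_of_mem_edge hx⟩

theorem edge_injective (h : IsSimplicialAt P v w f) : Function.Injective (edge P v f) := by
  intro i j hij
  by_contra hne
  have := h.add_mem_edge i
  rw [hij] at this
  have := (mem_edge.1 this).2 i hne
  simp only [add_sub_cancel_left] at this
  exact (h.pos i).ne' this

/-- A functional `l` maximal at `v` is nonpositive on all `w i`, and points of `P - v` have
nonnegative coefficients. Hence its face involves only those `w i` with `l (w i) = 0`, and in
dimension one there is exactly one of them. -/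
theorem eq_edge (h : IsSimplicialAt P v w f) {E : Set (Fin n → ℝ)} (hE : IsEdge P E)
    (hv : v ∈ E) : ∃ i, edge P v f i = E := by
  obtain ⟨l, hl⟩ := hE.1 ⟨v, hv⟩
  have hvmax : ∀ y ∈ P, l y ≤ l v := by
    rw [hl] at hv; exact hv.2
  have hmem : ∀ x, x ∈ E ↔ x ∈ P ∧ l (x - v) = 0 := by
    intro x
    rw [hl]
    simp only [Set.mem_ofPred_eq, map_sub, sub_eq_zero]
    refine and_congr_right fun hx => ⟨fun hy => le_antisymm (hvmax x hx) (hy v h.mem), ?_⟩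
    intro hx y hy
    rw [hx]; exact hvmax y hy
  have hlw : ∀ i, l (w i) ≤ 0 := fun i => by
    have := hvmax _ (h.add_mem i)
    rw [map_add] at this
    linarith
  have hcoef : ∀ x ∈ E, ∀ i, l (w i) ≠ 0 → f i (x - v) = 0 := by
    intro x hx i hi
    obtain ⟨hxP, hx0⟩ := (hmem x).1 hx
    have hs := h.exists_eq_sum (x - v)
    rw [hs, map_sum] at hx0
    have hnn : ∀ j, 0 ≤ f j (x - v) / f j (w j) := fun j => by
      refine div_nonneg ?_ (h.pos j).le
      rw [map_sub]
      linarith [h.le x hxP j]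
    have := (Finset.sum_eq_zero_iff_of_nonpos (fun j _ => by
      rw [map_smul, smul_eq_mul]
      exact mul_nonpos_of_nonneg_of_nonpos (hnn j) (hlw j))).1 hx0 i (Finset.mem_univ i)
    rw [map_smul, smul_eq_mul] at this
    have := (mul_eq_zero.1 this).resolve_right hi
    exact (div_eq_zero_iff.1 this).resolve_right (h.pos i).ne'
  have hdim : Module.finrank ℝ (vectorSpan ℝ E) = 1 := by
    rw [← direction_affineSpan]; exact hE.2
  have hw_mem : ∀ i, l (w i) = 0 → w i ∈ vectorSpan ℝ E := by
    intro i hi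
    have := vsub_mem_vectorSpan ℝ ((hmem (v + w i)).2 ⟨h.add_mem i, by simpa using hi⟩) hv
    simpa using this
  obtain ⟨i, hi⟩ : ∃ i, l (w i) = 0 := by
    by_contra! hno
    have hsub : E ⊆ {v} := by
      intro x hx
      have := h.exists_eq_sum (x - v)
      rw [Finset.sum_eq_zero fun j _ => by rw [hcoef x hx j (hno j), zero_div, zero_smul]] at this
      exact sub_eq_zero.1 this
    have hEv : E = {v} := Set.Subset.antisymm hsub (by simpa using hv)
    rw [hEv, vectorSpan_singleton] at hdim
    simp at hdim
  have huniq : ∀ j, l (w j) = 0 → j = i := by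
    intro j hj
    by_contra hne
    obtain ⟨c, hc⟩ := exists_smul_eq_of_finrank_eq_one hdim
      (x := ⟨w i, hw_mem i hi⟩) (by simpa [Subtype.ext_iff] using h.ne_zero i) ⟨w j, hw_mem j hj⟩
    have hc' : c • w i = w j := congrArg Subtype.val hc
    have := h.pos j
    rw [← hc', map_smul, h.eq_zero j i hne] at this
    simp at this
  refine ⟨i, Set.Subset.antisymm (fun x hx => ?_) fun x hx => ?_⟩
  · obtain ⟨c, hc⟩ := h.exists_smul_of_mem_edge hx
    exact (hmem x).2 ⟨(mem_edge.1 hx).1, by rw [hc, map_smul, hi, smul_zero]⟩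
  · exact mem_edge.2 ⟨((hmem x).1 hx).1, fun j hj => hcoef x hx j fun h0 => hj (huniq j h0)⟩

theorem encard_edges (h : IsSimplicialAt P v w f) :
    {E | IsEdge P E ∧ v ∈ E}.encard = n := by
  have : {E | IsEdge P E ∧ v ∈ E} = Set.range (edge P v f) := by
    ext E
    constructor
    · rintro ⟨hE, hv⟩
      exact h.eq_edge hE hv
    · rintro ⟨i, rfl⟩
      exact ⟨h.isEdge_edge i, h.self_mem_edge i⟩
  rw [this, ← Set.image_univ, h.edge_injective.encard_image, Set.encard_univ]
  simp

end IsSimplicialAt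

/-! ### Simplicial cones at the truncations -/

theorem comp_perm_mem (hu : Monotone u) (τ : Equiv.Perm (Fin n)) (x : Fin n → ℝ)
    (hx : x ∈ parkingPolytope u) : x ∘ τ ∈ parkingPolytope u := by
  have hc : Convex ℝ (LinearMap.funLeft ℝ ℝ τ ⁻¹' parkingPolytope u) :=
    (convex_convexHull ℝ _).linear_preimage _
  refine convexHull_min (fun a ha => ?_) hc hx
  obtain ⟨h0, σ, hσ⟩ := (isParkingFunction_iff hu).1 ha
  exact mem_of_le hu (fun i => h0 _) (τ.trans σ) (fun i => hσ _)

theorem sum_single_one (T : Finset (Fin n)) (a : Fin n) :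
    ∑ i ∈ T, (Pi.single a 1 : Fin n → ℝ) i = if a ∈ T then 1 else 0 := by
  simp [Pi.single_apply]

/-- The vertex looks like the corner of a cube: all surviving entries are maximal and can be lowered
to 0 independently, while a zeroed entry can be raised to the unused value `u q`. -/
theorem isSimplicialAt_truncation_of_le (hu : Monotone u) (h0 : ∀ i, 0 ≤ u i) {k : ℕ}
    (q : Fin n) (hq : (q : ℕ) = k - 1) (hqpos : 0 < k → 0 < u q)
    (hmax : ∀ i : Fin n, k ≤ i → 0 < u i ∧ ∀ j, u j ≤ u i) :
    ∃ w f, IsSimplicialAt (parkingPolytope u) (truncation u k) w f := by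
  refine ⟨fun j => if (j : ℕ) < k then u q • Pi.single j 1 else -(u j • Pi.single j 1),
    fun j => if (j : ℕ) < k then LinearMap.proj j else -LinearMap.proj j, ?_, ?_, ?_, ?_, ?_⟩
  · refine mem_of_le hu (fun i => ?_) 1 (fun i => ?_) <;> simp only [truncation] <;>
      split_ifs <;> simp [h0]
  · intro j
    by_cases hj : (j : ℕ) < k
    · refine mem_of_le hu (fun i => ?_) (Equiv.swap j q) (fun i => ?_)
      · by_cases hij : i = j
        · subst hij; simp [truncation, hj, h0]
        · by_cases hi : (i : ℕ) < k <;> simp [truncation, hj, hij, hi, h0]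
      · by_cases hij : i = j
        · subst hij; simp [truncation, hj]
        · by_cases hi : (i : ℕ) < k
          · simp [truncation, hj, hij, hi, h0]
          · have : i ≠ q := fun h => by subst h; omega
            simp [truncation, hj, hij, hi, Equiv.swap_apply_of_ne_of_ne hij this]
    · refine mem_of_le hu (fun i => ?_) 1 (fun i => ?_) <;>
      · by_cases hij : i = j
        · subst hij; simp [truncation, hj, h0]
        · by_cases hi : (i : ℕ) < k <;> simp [truncation, hj, hij, hi, h0]
  · intro j
    by_cases hj : (j : ℕ) < k
    · simpa [hj] using hqpos (by omega)
    · simpa [hj] using (hmax j (by omega)).1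
  · intro i j hij
    by_cases hj : (j : ℕ) < k <;> by_cases hi : (i : ℕ) < k <;> simp [hj, hi, hij]
  · intro x hx j
    by_cases hj : (j : ℕ) < k
    · simpa [hj, truncation] using nonneg_of_mem hx j
    · have hT : IsTop u {j} := by
        intro a ha b _
        rw [Finset.mem_singleton.1 ha]
        exact (hmax j (by omega)).2 b
      simpa [hj, truncation] using hT.sum_le hu hx

/-- Here `z` counts the zeros of `u`, and entries from `b` on are maximal. Surviving entries form a
strict chain up to `b`, followed by copies of the maximum that are each exchanged with the entry at
`b - 1`. The dual functionals are coordinates below `k`, tail sums on the chain, and single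
coordinates beyond it. -/
theorem isSimplicialAt_truncation_of_lt (hu : Monotone u) (h0 : ∀ i, 0 ≤ u i) {z b k : ℕ}
    (hz : ∀ i : Fin n, z ≤ i ↔ 0 < u i) (hbn : b ≤ n)
    (hmax : ∀ i : Fin n, b ≤ i → ∀ j, u j ≤ u i)
    (hlt : ∀ i j : Fin n, i < j → z ≤ i → (i : ℕ) < b → u i < u j)
    (hzk : z ≤ k) (hkb : k < b) :
    ∃ w f, IsSimplicialAt (parkingPolytope u) (truncation u k) w f := by
  classical
  have hzero : ∀ i : Fin n, (i : ℕ) < z → u i = 0 := fun i hi =>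
    le_antisymm (not_lt.1 fun h => absurd ((hz i).2 h) (by omega)) (h0 i)
  obtain ⟨κ, hκ⟩ : ∃ κ : Fin n, (κ : ℕ) = k := ⟨⟨k, by omega⟩, rfl⟩
  obtain ⟨q, hq⟩ : ∃ q : Fin n, (q : ℕ) = k - 1 := ⟨⟨k - 1, by omega⟩, rfl⟩
  -- The exchange partner: the predecessor of `j` on the chain, and `b - 1` for every `j ≥ b`.
  obtain ⟨p, hp⟩ : ∃ p : Fin n → Fin n, ∀ j, (p j : ℕ) = min (j : ℕ) b - 1 :=
    ⟨fun j => ⟨min (j : ℕ) b - 1, by omega⟩, fun j => rfl⟩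
  -- When `k = z` nothing positive has been removed, so the sum of all coordinates is tight. It
  -- replaces the tail sum at `k`, since it must vanish on exchanges of a zero with entry `k`.
  obtain ⟨T, hT⟩ : ∃ T : Fin n → Finset (Fin n), ∀ j i, i ∈ T j ↔
      i = j ∨ ((j : ℕ) ≤ i ∧ (j : ℕ) < b) ∨ ((j : ℕ) = k ∧ k = z) :=
    ⟨fun j => Finset.univ.filter fun i =>
      i = j ∨ ((j : ℕ) ≤ i ∧ (j : ℕ) < b) ∨ ((j : ℕ) = k ∧ k = z), fun j i => by simp⟩
  have hκpos : 0 < u κ := (hz κ).1 (by omega)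
  have hppos : ∀ j : Fin n, k < j → u (p j) < u j := fun j hj => by
    have := hp j
    exact hlt _ _ (by rw [Fin.lt_def]; omega) (by omega) (by omega)
  -- For `k = z` a zero can grow only at the expense of `κ`, as no positive value is unused; for `k
  -- > z` the value `u q` is free.
  refine ⟨fun j => if (j : ℕ) < k then
      (if k = z then u κ • (Pi.single j 1 - Pi.single κ 1) else u q • Pi.single j 1)
      else if j = κ then -(u κ • Pi.single κ 1)
      else (u j - u (p j)) • (Pi.single (p j) 1 - Pi.single j 1),
    fun j => if (j : ℕ) < k then LinearMap.proj j else -∑ i ∈ T j, LinearMap.proj i,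
    ?_, ?_, ?_, ?_, ?_⟩
  · refine mem_of_le hu (fun i => ?_) 1 (fun i => ?_) <;> simp only [truncation] <;>
      split_ifs <;> simp [h0]
  · intro j
    split_ifs with hj hkz hjκ
    · have hjκ : j ≠ κ := fun h => by subst h; omega
      refine mem_of_le hu (fun i => ?_) (Equiv.swap j κ) (fun i => ?_) <;>
      · by_cases hij : i = j
        · subst hij; simp [truncation, hj, h0, hjκ]
        · by_cases hiκ : i = κ
          · subst hiκ; simp [truncation, h0, hij, hκ]
          · by_cases hi : (i : ℕ) < k <;>
              simp [truncation, hij, hi, h0, hiκ, Equiv.swap_apply_of_ne_of_ne hij hiκ]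
    · refine mem_of_le hu (fun i => ?_) (Equiv.swap j q) (fun i => ?_)
      · by_cases hij : i = j
        · subst hij; simp [truncation, hj, h0]
        · by_cases hi : (i : ℕ) < k <;> simp [truncation, hij, hi, h0]
      · by_cases hij : i = j
        · subst hij; simp [truncation, hj]
        · by_cases hi : (i : ℕ) < k
          · simp [truncation, hij, hi, h0]
          · have : i ≠ q := fun h => by subst h; omega
            simp [truncation, hij, hi, Equiv.swap_apply_of_ne_of_ne hij this]
    · refine mem_of_le hu (fun i => ?_) 1 (fun i => ?_) <;>
      · by_cases hij : i = κ
        · subst hij; simp [truncation, hκ, h0]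
        · by_cases hi : (i : ℕ) < k <;> simp [truncation, hij, hi, h0]
    · have hkj : k < (j : ℕ) := by
        have : (j : ℕ) ≠ k := fun h => hjκ (Fin.ext (h.trans hκ.symm))
        omega
      have hpk : ¬ (p j : ℕ) < k := by have := hp j; omega
      have hpj : p j ≠ j := fun h => (hppos j hkj).ne (congrArg u h)
      refine mem_of_le hu (fun i => ?_) (Equiv.swap j (p j)) (fun i => ?_) <;>
      · by_cases hij : i = j
        · subst hij; simp [truncation, hj, h0, hpj.symm]
        · by_cases hip : i = p j
          · subst hip; simp [truncation, hpk, hpj, h0]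
          · by_cases hi : (i : ℕ) < k <;>
              simp [truncation, hij, hi, h0, hip, Equiv.swap_apply_of_ne_of_ne hij hip]
  · intro j
    by_cases hj : (j : ℕ) < k
    · have hjκ : j ≠ κ := fun h => by subst h; omega
      by_cases hkz : k = z
      · simpa [hj, hkz ▸ hj, hkz, hjκ] using hκpos
      · simpa [hj, hkz] using (hz q).1 (by omega)
    · by_cases hjκ : j = κ
      · subst hjκ
        have : j ∈ T j := (hT j j).2 (Or.inl rfl)
        simpa [hj, ← Finset.mul_sum, sum_single_one, this] using hκpos
      · have hkj : k < (j : ℕ) := by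
          have : (j : ℕ) ≠ k := fun h => hjκ (Fin.ext (h.trans hκ.symm))
          omega
        have hpj : p j ≠ j := fun h => (hppos j hkj).ne (congrArg u h)
        have h1 : j ∈ T j := (hT j j).2 (Or.inl rfl)
        have h2 : p j ∉ T j := by
          rw [hT]; have := hp j; rw [Fin.ext_iff]; omega
        simpa [hj, hjκ, ← Finset.mul_sum, Finset.sum_sub_distrib, sum_single_one, h1, h2]
          using hppos j hkj
  · intro i j hij
    have hij' : (i : ℕ) ≠ j := fun h => hij (Fin.ext h)
    by_cases hi : (i : ℕ) < k
    · have hiκ : i ≠ κ := fun h => by subst h; omega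
      by_cases hj : (j : ℕ) < k
      · by_cases hkz : k = z
        · simp [hkz, hij, hiκ, hkz ▸ hi, hkz ▸ hj]
        · simp [hi, hj, hkz, hij]
      · by_cases hjκ : j = κ
        · simp [hi, hκ, hjκ, hiκ]
        · have hip : i ≠ p j := fun h => by
            have := hp j; rw [← h] at this
            have : (j : ℕ) ≠ k := fun h => hjκ (Fin.ext (h.trans hκ.symm))
            omega
          simp [hi, hj, hjκ, hip, hij]
    · by_cases hj : (j : ℕ) < k
      · by_cases hkz : k = z
        · have : j ∈ T i ↔ κ ∈ T i := by
            rw [hT, hT, Fin.ext_iff, Fin.ext_iff]; omega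
          rw [if_neg hi, if_pos hj, if_pos hkz]
          simp [Finset.sum_sub_distrib, this]
        · have : j ∉ T i := by rw [hT, Fin.ext_iff]; omega
          simp [hi, hj, hkz, this]
      · by_cases hjκ : j = κ
        · have : κ ∉ T i := by rw [hT, Fin.ext_iff]; subst hjκ; omega
          simp [hi, hκ, hjκ, ← Finset.mul_sum, this]
        · have : p j ∈ T i ↔ j ∈ T i := by
            have := hp j
            have : (j : ℕ) ≠ k := fun h => hjκ (Fin.ext (h.trans hκ.symm))
            rw [hT, hT, Fin.ext_iff, Fin.ext_iff]; omega
          simp [hi, hj, hjκ, Finset.sum_sub_distrib, this]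
  · intro x hx j
    by_cases hj : (j : ℕ) < k
    · simpa [hj, truncation] using nonneg_of_mem hx j
    · have htop : IsTop u (T j) := by
        intro a ha c hc
        rw [hT, Fin.ext_iff] at ha hc
        by_cases hjb : (j : ℕ) < b
        · exact hu (Fin.le_def.2 (by omega))
        · exact hmax a (by omega) c
      have hval : ∀ i ∈ T j, truncation u k i = u i := by
        intro i hi
        rw [hT, Fin.ext_iff] at hi
        simp only [truncation]
        split_ifs with h
        · exact (hzero i (by omega)).symm
        · rfl
      have := htop.sum_le hu hx
      rw [← Finset.sum_congr rfl hval] at this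
      simpa [hj] using this

/-! ### Sufficiency of the condition on `u` -/

/-- Positive entries of `u` that are not maximal are pairwise distinct, and moreover `u` has no
zero entries, or it has a positive entry that is not maximal, or all its positive entries are
distinct. -/
def HasSimpleType (u : Fin n → ℝ) : Prop :=
  (∀ i j, i ≠ j → u i = u j → 0 < u i → ∀ k, u k ≤ u i) ∧
    ((∀ i, 0 < u i) ∨ (∃ i, 0 < u i ∧ ∃ k, u i < u k) ∨
      ∀ i j, 0 < u i → u i = u j → i = j)

theorem HasSimpleType.exists_threshold (hu : Monotone u) (h0 : ∀ i, 0 ≤ u i) (hne : u ≠ 0)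
    (h : HasSimpleType u) : ∃ z ≤ n, ∃ b ≤ n, (∀ i : Fin n, z ≤ i ↔ 0 < u i) ∧
      (∀ i : Fin n, b ≤ i → ∀ j, u j ≤ u i) ∧
      (∀ i j : Fin n, i < j → z ≤ i → (i : ℕ) < b → u i < u j) ∧ (z < b ∨ z = 0) := by
  obtain ⟨t, ht⟩ := Function.ne_iff.1 hne
  have ht : 0 < u t := lt_of_le_of_ne (h0 t) (Ne.symm ht)
  obtain ⟨z, hzn, hz⟩ := ParkingPolytope.exists_threshold (p := fun i => ¬ 0 < u i)
    (fun i j hij hj hi => hj (hi.trans_le (hu hij)))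
  have hz : ∀ i : Fin n, z ≤ i ↔ 0 < u i := fun i => by
    have := hz i; rw [← not_lt, this, not_not]
  obtain ⟨b, hbn, hb⟩ := ParkingPolytope.exists_threshold (p := fun i => ∃ k, u i < u k)
    (fun i j hij ⟨k, hk⟩ => ⟨k, (hu hij).trans_lt hk⟩)
  have hmax : ∀ i : Fin n, b ≤ i → ∀ j, u j ≤ u i := fun i hi j => by
    by_contra! hlt
    exact absurd ((hb i).2 ⟨j, hlt⟩) (by omega)
  have hlt : ∀ i j : Fin n, i < j → z ≤ i → (i : ℕ) < b → u i < u j := by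
    intro i j hij hzi hib
    refine lt_of_le_of_ne (hu hij.le) fun heq => ?_
    obtain ⟨k, hk⟩ := (hb i).1 hib
    exact absurd (h.1 i j hij.ne heq ((hz i).1 hzi) k) (not_le.2 hk)
  rcases h.2 with hpos | ⟨i, hi, hik⟩ | hinj
  · refine ⟨z, hzn, b, hbn, hz, hmax, hlt, Or.inr ?_⟩
    have := (hz ⟨0, t.pos⟩).2 (hpos _)
    simpa using this
  · refine ⟨z, hzn, b, hbn, hz, hmax, hlt, Or.inl ?_⟩
    exact ((hz i).2 hi).trans_lt ((hb i).2 hik)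
  -- With all positive entries distinct the chain may run to the end. Taking `b = n` secures `z < b`
  -- even if there is only one positive entry.
  · refine ⟨z, hzn, n, le_rfl, hz, fun i hi => absurd i.isLt (by omega), ?_, Or.inl ?_⟩
    · intro i j hij hzi _
      refine lt_of_le_of_ne (hu hij.le) fun heq => hij.ne (hinj i j ((hz i).1 hzi) heq)
    · exact ((hz t).2 ht).trans_lt t.isLt

theorem HasSimpleType.isSimplePolytope (hu : Monotone u) (h0 : ∀ i, 0 ≤ u i) (hne : u ≠ 0)
    (h : HasSimpleType u) : IsSimplePolytope (parkingPolytope u) := by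
  refine ⟨isPolytope hu h0, fun v hv => ?_⟩
  rw [affineDim_parkingPolytope hu h0 hne]
  obtain ⟨k, hkn, τ, rfl⟩ := exists_eq_truncation_comp hu h0 hv
  suffices H : ∃ w f, IsSimplicialAt (parkingPolytope u) (truncation u k) w f by
    obtain ⟨w, f, hwf⟩ := H
    exact (hwf.comp τ (comp_perm_mem hu)).encard_edges
  obtain ⟨z, hzn, b, hbn, hz, hmax, hlt, hzb⟩ := h.exists_threshold hu h0 hne
  obtain ⟨t, -⟩ := Function.ne_iff.1 hne
  have hn : 0 < n := t.pos
  -- Zeroing entries that are already 0 has no effect, so the cut may be moved up to `z`.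
  obtain ⟨k', hk'n, hzk', hk'⟩ : ∃ k' ≤ n, z ≤ k' ∧ truncation u k = truncation u k' := by
    refine ⟨max k z, by omega, by omega, ?_⟩
    ext i
    have := hz i
    have := h0 i
    simp only [truncation]
    split_ifs with h1 h2 h2
    · rfl
    · omega
    · exact le_antisymm (not_lt.1 fun h => absurd ((hz i).2 h) (by omega)) (h0 i)
    · rfl
  rw [hk']
  by_cases hkb : k' < b
  · exact isSimplicialAt_truncation_of_lt hu h0 hz hbn hmax hlt hzk' hkb
  · refine isSimplicialAt_truncation_of_le hu h0 ⟨k' - 1, by omega⟩ rfl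
      (fun hk => (hz _).1 ?_) fun i hi => ⟨(hz i).1 (by omega), hmax i (by omega)⟩
    simp only
    omega

/-! ### Edges at the vertex `u` -/

theorem self_mem (hu : Monotone u) (h0 : ∀ i, 0 ≤ u i) : u ∈ parkingPolytope u :=
  mem_of_le hu h0 1 fun _ => le_rfl

/-- `u i < u j` are consecutive values of `u`. -/
def IsCover (u : Fin n → ℝ) (i j : Fin n) : Prop :=
  u i < u j ∧ ∀ k, u k ≤ u i ∨ u j ≤ u k

/-- `u a` is the smallest positive value of `u`. -/
def IsBottom (u : Fin n → ℝ) (a : Fin n) : Prop :=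
  0 < u a ∧ ∀ k, u k = 0 ∨ u a ≤ u k

theorem apply_eq_of_sum_eq {T : Finset (Fin n)} {a : Fin n} {x : Fin n → ℝ} (ha : a ∉ T)
    (h1 : ∑ i ∈ T, x i = ∑ i ∈ T, u i)
    (h2 : ∑ i ∈ insert a T, x i = ∑ i ∈ insert a T, u i) : x a = u a := by
  rw [Finset.sum_insert ha, Finset.sum_insert ha] at h2
  linarith

theorem isTop_filter_lt (a : Fin n) : IsTop u {b | u a < u b} := by
  intro c hc b hb
  simp only [Finset.mem_filter, Finset.mem_univ, true_and, not_lt] at hc hb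
  linarith

theorem isTop_insert_filter_lt (a : Fin n) : IsTop u (insert a ({b | u a < u b} : Finset _)) := by
  intro c hc b hb
  simp only [Finset.mem_insert, Finset.mem_filter, Finset.mem_univ, true_and, not_or,
    not_lt] at hc hb
  rcases hc with rfl | hc <;> linarith [hb.2]

theorem isTop_filter_le_ne (a : Fin n) : IsTop u {b | u a ≤ u b ∧ b ≠ a} := by
  intro c hc b hb
  simp only [Finset.mem_filter, Finset.mem_univ, true_and, not_and, not_not] at hc hb
  by_cases h : u a ≤ u b
  · rw [hb h]; exact hc.1
  · linarith [hc.1]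

theorem isTop_insert_filter_le_ne (a : Fin n) :
    IsTop u (insert a ({b | u a ≤ u b ∧ b ≠ a} : Finset _)) := by
  intro c hc b hb
  simp only [Finset.mem_insert, Finset.mem_filter, Finset.mem_univ, true_and, not_or,
    not_and, not_not] at hc hb
  have hb' : u b < u a := by
    by_contra! h
    exact hb.1 (hb.2 h)
  rcases hc with rfl | hc
  · exact hb'.le
  · linarith [hc.1]

/-- Equality for two top sets that differ only by `a` forces `x a = u a`; such a pair exists for
every `a`. -/
theorem isVertex_self (hu : Monotone u) (h0 : ∀ i, 0 ≤ u i) :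
    IsVertex (parkingPolytope u) u := by
  classical
  have h := isExposed_of_family (self_mem hu h0) (Finset.univ.filter (IsTop u))
    (fun T => ∑ i ∈ T, LinearMap.proj i) (fun T hT x hx => by
      simpa using (Finset.mem_filter.1 hT).2.sum_le hu hx)
  unfold IsVertex
  convert h
  refine (Set.eq_singleton_iff_unique_mem.2 ⟨?_, ?_⟩).symm
  · exact Set.mem_sep (self_mem hu h0) fun _ _ => rfl
  rintro x ⟨-, hx⟩
  have hx : ∀ T, IsTop u T → ∑ i ∈ T, x i = ∑ i ∈ T, u i := fun T hT => by
    simpa using hx T (by simpa using hT)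
  ext a
  exact apply_eq_of_sum_eq (by simp) (hx _ (isTop_filter_lt a)) (hx _ (isTop_insert_filter_lt a))

/-- There is an edge of `PF(u)` through `u` in the direction of `w`. -/
def HasEdgeToward (u w : Fin n → ℝ) : Prop :=
  ∃ E, IsEdge (parkingPolytope u) E ∧ u ∈ E ∧ u + w ∈ E ∧ ∀ x ∈ E, ∃ c : ℝ, x - u = c • w

theorem hasEdgeToward_of_family {ι : Type*} (hu : Monotone u) (h0 : ∀ i, 0 ≤ u i)
    {w : Fin n → ℝ} (hw : w ≠ 0) (huw : u + w ∈ parkingPolytope u)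
    (s : Finset ι) (g : ι → (Fin n → ℝ) →ₗ[ℝ] ℝ)
    (hg : ∀ i ∈ s, ∀ x ∈ parkingPolytope u, g i x ≤ g i u) (hgw : ∀ i ∈ s, g i w = 0)
    (h : ∀ x, (∀ i ∈ s, g i x = g i u) → ∃ c : ℝ, x - u = c • w) : HasEdgeToward u w := by
  have h1 : u ∈ {x ∈ parkingPolytope u | ∀ i ∈ s, g i x = g i u} :=
    ⟨self_mem hu h0, fun _ _ => rfl⟩
  have h2 : u + w ∈ {x ∈ parkingPolytope u | ∀ i ∈ s, g i x = g i u} :=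
    ⟨huw, fun i hi => by rw [map_add, hgw i hi, add_zero]⟩
  exact ⟨_, ⟨isExposed_of_family (self_mem hu h0) s g hg,
    affineDim_eq_one h1 h2 hw fun x hx => h x hx.2⟩, h1, h2, fun x hx => h x hx.2⟩

theorem IsCover.ne {i j : Fin n} (h : IsCover u i j) : i ≠ j := fun he => by
  subst he; exact lt_irrefl _ h.1

/-- The tight top sets containing both or neither of `i`, `j` are constant along the exchange. As no
value lies strictly between `u i` and `u j`, they still fix every other coordinate. -/
theorem IsCover.hasEdgeToward (hu : Monotone u) (h0 : ∀ i, 0 ≤ u i) {i j : Fin n}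
    (h : IsCover u i j) :
    HasEdgeToward u ((u j - u i) • (Pi.single i 1 - Pi.single j 1)) := by
  classical
  have hij := h.ne
  have hpos : 0 < u j - u i := sub_pos.2 h.1
  refine hasEdgeToward_of_family hu h0 ?_ ?_
    (Finset.univ.filter fun T => IsTop u T ∧ (i ∈ T ↔ j ∈ T))
    (fun T => ∑ i ∈ T, LinearMap.proj i) ?_ ?_ ?_
  · intro hw
    have := congrFun hw i
    simp [hij, hpos.ne'] at this
  · refine mem_of_le hu (fun k => ?_) (Equiv.swap i j) (fun k => ?_) <;>
    · by_cases hki : k = i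
      · subst hki; simp [hij, h0]
      · by_cases hkj : k = j
        · subst hkj; simp [hki, h0]
        · simp [hki, hkj, h0, Equiv.swap_apply_of_ne_of_ne]
  · intro T hT x hx
    simpa using (Finset.mem_filter.1 hT).2.1.sum_le hu hx
  · intro T hT
    have := (Finset.mem_filter.1 hT).2.2
    simp [Finset.sum_sub_distrib, this]
  · intro x hx
    have hx : ∀ T, IsTop u T → (i ∈ T ↔ j ∈ T) → ∑ i ∈ T, x i = ∑ i ∈ T, u i := fun T hT hT' => by
      simpa using hx T (by simpa using ⟨hT, hT'⟩)
    have hoff : ∀ a, a ≠ i → a ≠ j → x a = u a := by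
      intro a hai haj
      rcases h.2 a with ha | ha
      · refine apply_eq_of_sum_eq (by simp) (hx _ (isTop_filter_le_ne a) ?_)
          (hx _ (isTop_insert_filter_le_ne a) ?_)
        · simp [ha, hai.symm, haj.symm, ha.trans h.1.le]
        · simp [ha, hai.symm, haj.symm, ha.trans h.1.le]
      · refine apply_eq_of_sum_eq (by simp) (hx _ (isTop_filter_lt a) ?_)
          (hx _ (isTop_insert_filter_lt a) ?_)
        · simp [ha.not_gt, (h.1.le.trans ha).not_gt]
        · simp [ha.not_gt, (h.1.le.trans ha).not_gt, hai.symm, haj.symm]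
    -- The full set is vacuously top, so the changes at `i` and `j` cancel.
    have hsum := hx Finset.univ (by intro _ _ b hb; simp at hb) (by simp)
    rw [← sub_eq_zero, ← Finset.sum_sub_distrib, Finset.sum_eq_add i j hij
      (fun a _ ha => sub_eq_zero.2 (hoff a ha.1 ha.2)) (by simp) (by simp)] at hsum
    refine ⟨(x i - u i) / (u j - u i), ?_⟩
    rw [smul_smul, div_mul_cancel₀ _ hpos.ne']
    ext a
    by_cases hai : a = i
    · subst hai; simp [hij]
    · by_cases haj : a = j
      · subst haj; simp [hai]; linarith
      · simp [hai, haj, hoff a hai haj]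

/-- The top sets avoiding `a` fix all other positive entries; the inequalities `0 ≤ x i` fix the
zeros. -/
theorem IsBottom.hasEdgeToward (hu : Monotone u) (h0 : ∀ i, 0 ≤ u i) {a : Fin n}
    (h : IsBottom u a) : HasEdgeToward u (-(u a • Pi.single a 1)) := by
  classical
  refine hasEdgeToward_of_family hu h0 ?_ ?_
    ((Finset.univ.filter fun T => IsTop u T ∧ a ∉ T).disjSum
      (Finset.univ.filter fun i => u i = 0))
    (Sum.elim (fun T => ∑ i ∈ T, LinearMap.proj i) fun i => -LinearMap.proj i) ?_ ?_ ?_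
  · intro hw
    have := congrFun hw a
    simp [h.1.ne'] at this
  · refine mem_of_le hu (fun k => ?_) 1 (fun k => ?_) <;>
    · by_cases hk : k = a
      · subst hk; simp [h0]
      · simp [hk, h0]
  · rintro (T | i) hT x hx
    · simp only [Finset.inl_mem_disjSum, Finset.mem_filter] at hT
      simpa using hT.2.1.sum_le hu hx
    · simp only [Finset.inr_mem_disjSum, Finset.mem_filter] at hT
      simpa [hT.2] using nonneg_of_mem hx i
  · rintro (T | i) hT
    · simp only [Finset.inl_mem_disjSum, Finset.mem_filter] at hT
      simp [← Finset.mul_sum, hT.2.2]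
    · simp only [Finset.inr_mem_disjSum, Finset.mem_filter] at hT
      have : i ≠ a := fun hi => h.1.ne' (hi ▸ hT.2)
      simp [this]
  · intro x hx
    have hx1 : ∀ T, IsTop u T → a ∉ T → ∑ i ∈ T, x i = ∑ i ∈ T, u i := fun T hT hT' => by
      simpa using hx (Sum.inl T) (by simpa using ⟨hT, hT'⟩)
    have hx2 : ∀ i, u i = 0 → x i = u i := fun i hi => by
      simpa using hx (Sum.inr i) (by simpa using hi)
    have hoff : ∀ b, b ≠ a → x b = u b := by
      intro b hb
      rcases h.2 b with hb0 | hab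
      · exact hx2 b hb0
      · refine apply_eq_of_sum_eq (by simp) (hx1 _ (isTop_filter_lt b) ?_)
          (hx1 _ (isTop_insert_filter_lt b) ?_)
        · simp [hab]
        · simp [hab, hb.symm]
    refine ⟨-((x a - u a) / u a), ?_⟩
    rw [neg_smul_neg, smul_smul, div_mul_cancel₀ _ h.1.ne']
    ext b
    by_cases hb : b = a
    · subst hb; simp
    · simp [hb, hoff b hb]

/-- The direction of an edge at `u`: towards a smaller entry `a`, or towards the exchange of the
entries `i` and `j`. -/
def direction (u : Fin n → ℝ) : Fin n ⊕ Fin n × Fin n → Fin n → ℝ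
  | Sum.inl a => -(u a • Pi.single a 1)
  | Sum.inr (i, j) => (u j - u i) • (Pi.single i 1 - Pi.single j 1)

/-- The labels of the edges at `u`. -/
def IsEdgeLabel (u : Fin n → ℝ) : Fin n ⊕ Fin n × Fin n → Prop
  | Sum.inl a => IsBottom u a
  | Sum.inr (i, j) => IsCover u i j

theorem IsEdgeLabel.hasEdgeToward (hu : Monotone u) (h0 : ∀ i, 0 ≤ u i) :
    ∀ {L}, IsEdgeLabel u L → HasEdgeToward u (direction u L)
  | Sum.inl _, h => IsBottom.hasEdgeToward hu h0 h
  | Sum.inr (_, _), h => IsCover.hasEdgeToward hu h0 h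

theorem direction_apply_inl (a k : Fin n) :
    direction u (Sum.inl a) k = if k = a then -u a else 0 := by
  by_cases h : k = a
  · subst h; simp [direction]
  · simp [direction, h]

theorem direction_apply_inr {i j : Fin n} (hij : i ≠ j) (k : Fin n) :
    direction u (Sum.inr (i, j)) k =
      if k = i then u j - u i else if k = j then -(u j - u i) else 0 := by
  by_cases h : k = i
  · subst h; simp [direction, hij]
  · by_cases h' : k = j
    · subst h'; simp [direction, h]
    · simp [direction, h, h']

/-- Proportional directions have the same support, and the support determines the label: `(i, j)`
and `(j, i)` cannot both be covers. Hence distinct labels give distinct edges. -/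
theorem IsEdgeLabel.eq_of_smul {L L' : Fin n ⊕ Fin n × Fin n} (hL : IsEdgeLabel u L)
    (hL' : IsEdgeLabel u L') {c : ℝ} (h : direction u L = c • direction u L') : L = L' := by
  have h : ∀ k, direction u L k = c * direction u L' k := fun k => congrFun h k
  rcases L with a | ⟨i, j⟩ <;> rcases L' with a' | ⟨i', j'⟩
  · have h1 := hL.1
    have h2 := h a
    simp only [direction_apply_inl] at h2
    by_cases haa : a = a'
    · rw [haa]
    · simp [haa] at h2; linarith
  · have hne := IsCover.ne hL'
    have h1 := hL.1
    have h2 := hL'.1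
    simp only [direction_apply_inl, direction_apply_inr hne] at h
    have h3 := h a
    have h4 := h i'
    have h5 := h j'
    have hc : c ≠ 0 := by
      rintro rfl
      simp at h3; linarith
    have hd : c * (u j' - u i') ≠ 0 := mul_ne_zero hc (sub_pos.2 h2).ne'
    by_cases hia : i' = a
    · have : ¬ j' = a := fun hj => hne (hia.trans hj.symm)
      simp [this, hne.symm] at h5
      grind
    · simp [hia] at h4
      grind
  · have hne := IsCover.ne hL
    have h2 := hL.1
    simp only [direction_apply_inl, direction_apply_inr hne] at h
    have h4 := h i
    have h5 := h j
    by_cases hia : i = a'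
    · have : ¬ j = a' := fun hj => hne (hia.trans hj.symm)
      simp [this, hne.symm] at h5
      linarith
    · simp [hia] at h4
      linarith
  · have hne := IsCover.ne hL
    have hne' := IsCover.ne hL'
    have h1 := hL.1
    have h2 := hL'.1
    simp only [direction_apply_inr hne, direction_apply_inr hne'] at h
    have h3 := h i
    have h4 := h j
    grind

/-! ### Necessity: more than n edges at `u` -/

theorem le_encard_edges (hu : Monotone u) (h0 : ∀ i, 0 ≤ u i)
    {ι : Type*} [Fintype ι] (g : ι → Fin n ⊕ Fin n × Fin n) (hg : ∀ i, IsEdgeLabel u (g i))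
    (hinj : Function.Injective g) :
    (Fintype.card ι : ℕ∞) ≤ {E | IsEdge (parkingPolytope u) E ∧ u ∈ E}.encard := by
  choose E hE using fun i => (hg i).hasEdgeToward hu h0
  have hEinj : Function.Injective E := by
    intro i j hij
    have h1 := (hE i).2.2.1
    rw [hij] at h1
    obtain ⟨c, hc⟩ := (hE j).2.2.2 _ h1
    rw [add_sub_cancel_left] at hc
    exact hinj ((hg i).eq_of_smul (hg j) hc)
  have hsub : Set.range E ⊆ {E | IsEdge (parkingPolytope u) E ∧ u ∈ E} := by
    rintro _ ⟨i, rfl⟩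
    exact ⟨(hE i).1, (hE i).2.1⟩
  refine le_trans (le_of_eq ?_) (Set.encard_le_encard hsub)
  rw [← Set.image_univ, hEinj.encard_image, Set.encard_univ]
  simp

theorem exists_isCover_left {j k : Fin n} (h : u k < u j) :
    ∃ i, IsCover u i j ∧ u k ≤ u i := by
  obtain ⟨i, hi, hmax⟩ := Finset.exists_max_image (Finset.univ.filter fun i => u i < u j) u
    ⟨k, by simpa using h⟩
  simp only [Finset.mem_filter, Finset.mem_univ, true_and] at hi hmax
  refine ⟨i, ⟨hi, fun l => ?_⟩, hmax k h⟩
  by_cases hl : u l < u j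
  · exact Or.inl (hmax l hl)
  · exact Or.inr (not_lt.1 hl)

theorem exists_isCover_right {i k : Fin n} (h : u i < u k) : ∃ j, IsCover u i j := by
  obtain ⟨j, hj, hmin⟩ := Finset.exists_min_image (Finset.univ.filter fun j => u i < u j) u
    ⟨k, by simpa using h⟩
  simp only [Finset.mem_filter, Finset.mem_univ, true_and] at hj hmin
  refine ⟨j, hj, fun l => ?_⟩
  by_cases hl : u i < u l
  · exact Or.inr (hmin l hl)
  · exact Or.inl (not_lt.1 hl)

theorem exists_isBottom (h0 : ∀ i, 0 ≤ u i) (hne : u ≠ 0) : ∃ s, IsBottom u s := by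
  obtain ⟨t, ht⟩ := Function.ne_iff.1 hne
  have ht : 0 < u t := lt_of_le_of_ne (h0 t) (Ne.symm ht)
  obtain ⟨s, hs, hmin⟩ := Finset.exists_min_image (Finset.univ.filter fun j => 0 < u j) u
    ⟨t, by simpa using ht⟩
  simp only [Finset.mem_filter, Finset.mem_univ, true_and] at hs hmin
  refine ⟨s, hs, fun l => ?_⟩
  by_cases hl : 0 < u l
  · exact Or.inr (hmin l hl)
  · exact Or.inl (le_antisymm (not_lt.1 hl) (h0 l))

theorem lt_encard_edges (hu : Monotone u) (h0 : ∀ i, 0 ≤ u i) (hne : u ≠ 0)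
    (h : ¬ HasSimpleType u) :
    (n : ℕ∞) < {E | IsEdge (parkingPolytope u) E ∧ u ∈ E}.encard := by
  classical
  obtain ⟨s, hs⟩ := exists_isBottom h0 hne
  -- `π j` is one chosen entry carrying the next smaller positive value; its value is irrelevant if
  -- `u j` is zero or smallest positive.
  have hπ : ∀ j, ∃ i, u j = 0 ∨ IsBottom u j ∨ (IsCover u i j ∧ 0 < u i) := by
    intro j
    by_cases hj : u j = 0
    · exact ⟨j, Or.inl hj⟩
    by_cases hb : IsBottom u j
    · exact ⟨j, Or.inr (Or.inl hb)⟩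
    have hlt : u s < u j := by
      by_contra! hle
      exact hb ⟨lt_of_le_of_ne (h0 j) (Ne.symm hj), fun k => (hs.2 k).imp_right hle.trans⟩
    obtain ⟨i, hi, hsi⟩ := exists_isCover_left hlt
    exact ⟨i, Or.inr (Or.inr ⟨hi, hs.1.trans_le hsi⟩)⟩
  choose π hπ using hπ
  -- The surplus edge: either a second lower neighbour of `j` with a repeated positive value, or a
  -- zero exchanged with a bottom entry other than `s`.
  obtain ⟨i, j, hij, hextra⟩ : ∃ i j, IsCover u i j ∧
      ((0 < u i ∧ i ≠ π j) ∨ (u i = 0 ∧ j ≠ s)) := by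
    unfold HasSimpleType at h
    rw [not_and_or] at h
    rcases h with h | h
    · push Not at h
      obtain ⟨i, i', hii', heq, hpos, k, hk⟩ := h
      obtain ⟨j, hj⟩ := exists_isCover_right hk
      by_cases hi : i = π j
      · refine ⟨i', j, ?_, Or.inl ⟨heq ▸ hpos, fun h => hii' (hi.trans h.symm)⟩⟩
        rw [IsCover, ← heq]; exact hj
      · exact ⟨i, j, hj, Or.inl ⟨hpos, hi⟩⟩
    · push Not at h
      obtain ⟨⟨z, hz⟩, hmax, j, j', hj, hjj, hne'⟩ := h
      have hz0 : u z = 0 := le_antisymm hz (h0 z)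
      have hcov : ∀ l, 0 < u l → IsCover u z l := fun l hl => by
        refine ⟨hz0 ▸ hl, fun k => ?_⟩
        by_cases hk : 0 < u k
        · exact Or.inr (hmax k hk l)
        · exact Or.inl (hz0 ▸ not_lt.1 hk)
      by_cases hjs : j = s
      · exact ⟨z, j', hcov j' (hjj ▸ hj), Or.inr ⟨hz0, fun h => hne' (hjs.trans h.symm)⟩⟩
      · exact ⟨z, j, hcov j hj, Or.inr ⟨hz0, hjs⟩⟩
  -- Each index gives one label: a zero is exchanged with `s`, a bottom entry is lowered, any other
  -- entry is exchanged with its `π`. The surplus label goes to `none`. The sign of the first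
  -- entry's value separates the two kinds of exchange.
  have key := le_encard_edges hu h0 (ι := Option (Fin n))
    (fun o => o.elim (Sum.inr (i, j)) fun k =>
      if u k = 0 then Sum.inr (k, s) else if IsBottom u k then Sum.inl k else Sum.inr (π k, k))
    (by
      rintro (_ | k)
      · exact hij
      · simp only [Option.elim_some]
        split_ifs with h1 h2
        · refine ⟨h1 ▸ hs.1, fun l => ?_⟩
          rw [h1]
          exact (hs.2 l).imp_left fun h => h.le
        · exact h2
        · exact (((hπ k).resolve_left h1).resolve_left h2).1)
    (by
      have hπpos : ∀ k, u k ≠ 0 → ¬ IsBottom u k → 0 < u (π k) := fun k h1 h2 =>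
        (((hπ k).resolve_left h1).resolve_left h2).2
      rintro (_ | k) (_ | k') hkk
      · rfl
      · simp only [Option.elim_some, Option.elim_none] at hkk
        split_ifs at hkk with h1 h2
        · simp only [Sum.inr.injEq, Prod.mk.injEq] at hkk
          grind
        · simp only [Sum.inr.injEq, Prod.mk.injEq] at hkk
          have := hπpos k' h1 h2
          grind
      · simp only [Option.elim_some, Option.elim_none] at hkk
        split_ifs at hkk with h1 h2
        · simp only [Sum.inr.injEq, Prod.mk.injEq] at hkk
          grind
        · simp only [Sum.inr.injEq, Prod.mk.injEq] at hkk
          have := hπpos k h1 h2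
          grind
      · simp only [Option.elim_some] at hkk
        congr 1
        split_ifs at hkk with h1 h2 h3 h4 h5 h6 <;>
          simp only [Sum.inr.injEq, Prod.mk.injEq, Sum.inl.injEq] at hkk
        all_goals grind)
  rw [Fintype.card_option, Fintype.card_fin] at key
  refine lt_of_lt_of_le ?_ key
  exact_mod_cast Nat.lt_succ_self n

theorem isSimplePolytope_iff (hu : Monotone u) (h0 : ∀ i, 0 ≤ u i) (hne : u ≠ 0) :
    IsSimplePolytope (parkingPolytope u) ↔ HasSimpleType u := by
  refine ⟨fun h => ?_, fun h => h.isSimplePolytope hu h0 hne⟩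
  by_contra hns
  have h1 := lt_encard_edges hu h0 hne hns
  rw [h.2 u (isVertex_self hu h0), affineDim_parkingPolytope hu h0 hne] at h1
  exact lt_irrefl _ h1

/-! ### Translation into multiplicities -/

theorem eq_zero_or_exists {ℓ : ℕ} {m : Fin (ℓ + 1) → ℕ} {d : Fin ℓ → ℝ} (h : IsMDPair u m d)
    (j : Fin n) : u j = 0 ∨ ∃ i, d i = u j := by
  by_cases hj : u j = 0
  · exact Or.inl hj
  · have : u j ∈ Set.range d := by
      rw [h.range_eq]
      exact ⟨⟨j, rfl⟩, lt_of_le_of_ne (h.nonneg j) (Ne.symm hj)⟩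
    exact Or.inr this

theorem exists_apply_eq {ℓ : ℕ} {m : Fin (ℓ + 1) → ℕ} {d : Fin ℓ → ℝ} (h : IsMDPair u m d)
    (i : Fin ℓ) : (∃ j, u j = d i) ∧ 0 < d i := by
  have : d i ∈ Set.range d := ⟨i, rfl⟩
  rw [h.range_eq] at this
  exact this

/-- For `ℓ = 1` the first clause of `HasSimpleType` is automatic and the second says `m 0 = 0` or `m
1 = 1`. For `ℓ ≥ 2` the second clause holds because `d 0 < d 1`, and the first says that all values
below the largest have multiplicity one. -/
theorem hasSimpleType_iff {ℓ : ℕ} {m : Fin (ℓ + 1) → ℕ} {d : Fin ℓ → ℝ} (h : IsMDPair u m d) :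
    HasSimpleType u ↔
      List.ofFn m = [0, n] ∨ List.ofFn m = [n - 1, 1] ∨
        (2 ≤ ℓ ∧ ∀ i : Fin (ℓ + 1), 1 ≤ (i : ℕ) → (i : ℕ) ≤ ℓ - 1 → m i = 1) := by
  classical
  obtain ⟨t, ht⟩ := Function.ne_iff.1 h.ne_zero
  have ht : 0 < u t := lt_of_le_of_ne (h.nonneg t) (Ne.symm ht)
  rcases ℓ with _ | _ | ℓ
  · rcases eq_zero_or_exists h t with h0 | ⟨i, -⟩
    · exact absurd h0 ht.ne'
    · exact i.elim0
  · have hval : ∀ j, 0 < u j → u j = d 0 := fun j hj => by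
      rcases eq_zero_or_exists h j with h0 | ⟨i, hi⟩
      · exact absurd h0 hj.ne'
      · rw [← hi, Fin.fin_one_eq_zero i]
    have hd : 0 < d 0 := (exists_apply_eq h 0).2
    have hsum : m 0 + m 1 = n := by
      have h1 := h.mult_succ 0
      have h2 : (Finset.univ.filter fun j => u j = d 0) =
          Finset.univ.filter fun j => ¬ u j = 0 := by
        ext j
        simp only [Finset.mem_filter, Finset.mem_univ, true_and]
        exact ⟨fun h h' => hd.ne' (h.symm.trans h'),
          fun h' => hval j (lt_of_le_of_ne (h.nonneg j) (Ne.symm h'))⟩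
      rw [h2] at h1
      rw [h.mult_zero, show (1 : Fin 2) = Fin.succ 0 from rfl, h1,
        Finset.card_filter_add_card_filter_not]
      simp
    have hlist : ∀ a b, List.ofFn m = [a, b] ↔ m 0 = a ∧ m 1 = b := fun a b => by
      simp [List.ofFn_succ]
    have hm0 : m 0 = 0 ↔ ∀ i, 0 < u i := by
      rw [h.mult_zero, Finset.card_eq_zero, Finset.filter_eq_empty_iff]
      exact ⟨fun hi i => lt_of_le_of_ne (h.nonneg i) (Ne.symm (hi (Finset.mem_univ i))),
        fun hi i _ => (hi i).ne'⟩
    have hm1 : m 1 = 1 ↔ ∀ i j, 0 < u i → u i = u j → i = j := by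
      have h1 : m 1 = _ := h.mult_succ 0
      rw [h1, Finset.card_eq_one]
      constructor
      · rintro ⟨a, ha⟩ i j hi hij
        have : ∀ l, u l = d 0 → l = a := fun l hl => by
          have : l ∈ Finset.univ.filter fun j => u j = d 0 := by simpa using hl
          rw [ha] at this
          simpa using this
        rw [this i (hval i hi), this j (hval j (hij ▸ hi))]
      · intro hinj
        refine ⟨t, ?_⟩
        ext j
        simp only [Finset.mem_filter, Finset.mem_univ, true_and, Finset.mem_singleton]
        exact ⟨fun hj => (hinj t j ht ((hval t ht).trans hj.symm)).symm,
          fun hj => hj ▸ hval t ht⟩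
    rw [hlist, hlist]
    constructor
    · rintro ⟨-, hpos | ⟨i, hi, k, hk⟩ | hinj⟩
      · have := hm0.2 hpos
        omega
      · exact absurd ((hval i hi).trans (hval k (hi.trans hk)).symm) hk.ne
      · have := hm1.2 hinj
        omega
    · intro hcase
      refine ⟨fun i j _ _ hi k => ?_, ?_⟩
      · by_cases hk : 0 < u k
        · rw [hval k hk, hval i hi]
        · exact (not_lt.1 hk).trans hi.le
      · rcases hcase with hcase | hcase | hcase
        · exact Or.inl (hm0.1 hcase.1)
        · exact Or.inr (Or.inr (hm1.1 hcase.2))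
        · omega
  · constructor
    · rintro ⟨hdist, -⟩
      refine Or.inr (Or.inr ⟨by omega, fun i h1 h2 => ?_⟩)
      obtain ⟨i, rfl⟩ := Fin.exists_succ_eq.2 (show i ≠ 0 from fun h => by simp [h] at h1)
      obtain ⟨⟨j, hj⟩, hpos⟩ := exists_apply_eq h i
      obtain ⟨⟨k, hk⟩, -⟩ := exists_apply_eq h (Fin.last _)
      have hlt : d i < d (Fin.last _) := h.strictMono (by
        rw [Fin.lt_def]; simp only [Fin.val_succ, Fin.val_last] at *; omega)
      rw [h.mult_succ, Finset.card_eq_one]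
      refine ⟨j, Finset.eq_singleton_iff_unique_mem.2 ⟨by simpa using hj, fun l hl => ?_⟩⟩
      have hl : u l = d i := by simpa using hl
      by_contra hne
      have := hdist l j hne (hl.trans hj.symm) (hl ▸ hpos) k
      rw [hk, hl] at this
      exact absurd hlt (not_lt.2 this)
    · rintro (hc | hc | ⟨-, hc⟩)
      · simpa using congrArg List.length hc
      · simpa using congrArg List.length hc
      · refine ⟨fun i j hij heq hi k => ?_, Or.inr (Or.inl ?_)⟩
        · by_contra! hk
          obtain ⟨a, ha⟩ := (eq_zero_or_exists h i).resolve_left hi.ne'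
          obtain ⟨b, hb⟩ := (eq_zero_or_exists h k).resolve_left (hi.trans hk).ne'
          rw [← ha, ← hb] at hk
          have hab := h.strictMono.lt_iff_lt.1 hk
          rw [Fin.lt_def] at hab
          have hone := hc a.succ (by simp) (by simp only [Fin.val_succ]; omega)
          rw [h.mult_succ, Finset.card_eq_one] at hone
          obtain ⟨l, hl⟩ := hone
          have hmem : ∀ x, u x = d a → x = l := fun x hx => by
            have : x ∈ Finset.univ.filter fun j => u j = d a := by simpa using hx
            rw [hl] at this
            simpa using this
          exact hij ((hmem i ha.symm).trans (hmem j (heq.symm.trans ha.symm)).symm)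
        · obtain ⟨⟨j, hj⟩, hpos⟩ := exists_apply_eq h 0
          obtain ⟨⟨k, hk⟩, -⟩ := exists_apply_eq h 1
          exact ⟨j, hj ▸ hpos, k, by rw [hj, hk]; exact h.strictMono (by simp)⟩

end ParkingPolytope

theorem mainTheorem8 {n ℓ : ℕ} (u : Fin n → ℝ) (m : Fin (ℓ + 1) → ℕ) (d : Fin ℓ → ℝ)
    (h : IsMDPair u m d) :
    IsSimplePolytope (parkingPolytope u) ↔
      List.ofFn m = [0, n] ∨ List.ofFn m = [n - 1, 1] ∨
        (2 ≤ ℓ ∧ ∀ i : Fin (ℓ + 1), 1 ≤ (i : ℕ) → (i : ℕ) ≤ ℓ - 1 → m i = 1) :=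
  (ParkingPolytope.isSimplePolytope_iff h.monotone h.nonneg h.ne_zero).trans
    (ParkingPolytope.hasSimpleType_iff h)
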